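/- Let $n$ be an integer with $n > 1$, and let $\kappa$ be a cardinal with $\omega \le \kappa < 2^{\omega}$. Assume $MA_\kappa(\sigma\text{-centered})$: whenever $P$ is a nonempty partially ordered set that is $\sigma$-centered (that is, $P$ is a union of countably many subsets, each of which has the property that every finite subset of it has a common lower bound in $P$) and $\mathcal{D}$ is a family of at most $\kappa$ dense subsets of $P$ (where $D \subseteq P$ is dense if every $p \in P$ has some $q \in D$ with $q \le p$), there is a filter $G \subseteq P$ (nonempty, upward closed, and such that any two elements of $G$ have a common lower bound in $G$) with $G \cap D \ne \emptyset$ for every $D \in \mathcal{D}$. Then there are a compact convex set $C \subseteq \mathbb{R}^n$ and a family $\mathcal{H}$ of closed subsets of $\mathbb{R}^n$ (a simple cover: no set is used more than once) such that 1. every $H \in \mathcal{H}$ is an isometric copy of $C$, i.e. the image of $C$ under an isometry of Euclidean space $\mathbb{R}^n$ onto itself; 2. $\mathcal{H}$ is a $\kappa$-fold cover of $\mathbb{R}^n$: every $x \in \mathbb{R}^n$ belongs to at least $\kappa$ members of $\mathcal{H}$; 3. $\mathcal{H}$ cannot be decomposed into two disjoint subcovers: there are no disjoint $\mathcal{A},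 \mathcal{B} \subseteq \mathcal{H}$ such that each of $\mathcal{A}$ and $\mathcal{B}$ covers $\mathbb{R}^n$. -/

import Mathlib

/-- The partial order `P` is σ-centered: it is a union of countably many centered sets, where a set
is centered if each of its finite subsets has a common lower bound (a common extension) in `P`. -/
def IsSigmaCentered (P : Type) [PartialOrder P] : Prop :=
  ∃ C : ℕ → Set P, (⋃ k, C k) = Set.univ ∧
    ∀ k, ∀ s : Finset P, (s : Set P) ⊆ C k → ∃ q : P, ∀ p ∈ s, q ≤ p

/-- `D` is dense in `P` in the sense of forcing: every condition has an extension in `D`. -/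
def IsForcingDense {P : Type} [PartialOrder P] (D : Set P) : Prop :=
  ∀ p : P, ∃ q ∈ D, q ≤ p

/-- Martin's Axiom `MA_κ(σ-centered)`: for every nonempty σ-centered partial order and every family
of at most `κ` dense sets there is a filter (nonempty, upward closed, downward directed) which
meets all of them. -/
def MASigmaCentered (κ : Cardinal.{0}) : Prop :=
  ∀ (P : Type) [PartialOrder P] [Nonempty P], IsSigmaCentered P →
    ∀ 𝒟 : Set (Set P), Cardinal.mk 𝒟 ≤ κ → (∀ D ∈ 𝒟, IsForcingDense D) →
      ∃ G : Order.PFilter P, ∀ D ∈ 𝒟, ∃ p ∈ D, p ∈ G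

/-- The family `ℋ` (a simple cover: each set is used at most once) covers every point of `X`. -/
def IsCoverOf {X : Type} (ℋ : Set (Set X)) : Prop :=
  ∀ x : X, ∃ H ∈ ℋ, x ∈ H

/-- The simple cover `ℋ` is `κ`-fold: every point of `X` lies in at least `κ` members of `ℋ`. -/
def IsFoldCover {X : Type} (κ : Cardinal.{0}) (ℋ : Set (Set X)) : Prop :=
  ∀ x : X, κ ≤ Cardinal.mk {H : Set X // H ∈ ℋ ∧ x ∈ H}

/-- `ℋ` can be decomposed into two disjoint subcovers. (Members of `ℋ` that are in neither of the
subcovers may be added to one of them, so that the union of the two need not be mentioned.) -/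
def SplitsIntoTwoCovers {X : Type} (ℋ : Set (Set X)) : Prop :=
  ∃ 𝒜 ℬ : Set (Set X), 𝒜 ⊆ ℋ ∧ ℬ ⊆ ℋ ∧ Disjoint 𝒜 ℬ ∧ IsCoverOf 𝒜 ∧ IsCoverOf ℬ

/-- `H` is an isometric copy of `C`: the image of `C` under an isometry of the whole space. -/
def IsIsometricCopy {X : Type} [PseudoEMetricSpace X] (H C : Set X) : Prop :=
  ∃ f : X ≃ᵢ X, H = f '' C

/-!
The cover has `κ` times countably many sets `H α n`, one for each level `n` of each of `κ` branches
`α` of the binary tree, and further sets that matter only for the multiplicity.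

*Combinatorics.* Every set `d` of nodes of the tree has a point `pt d`, and `pt d ∈ H α n` means that
`n` is the last level at which `α` meets `d`. Colour the sets `H α n` with two colours. One colour is
used at infinitely many levels on `κ` branches. Martin's Axiom for a forcing with finite sets of
nodes and finitely many frozen branches gives a set `d` which these branches meet for the last time
at a level of that colour, while all other branches meet `d` infinitely often
(`MASigmaCentered.exists_lastHit`). So `pt d` lies in `κ` of the sets `H α n`, all of one colour, and
the other colour class does not cover it, as long as no further set of the cover contains `pt d`.

*Geometry.* The convex set is the closed convex hull of points on a short arc of a unit circle with
a compact set `A` of angles; it contains no other points of the arc. The sets `H α n` are its images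
under reflections that exchange the angles `θ` and `t - θ`. So the point of angle `-a` lies in the
image with parameter `b` if and only if `b + a ∈ A`. Since two Cantor sets can be chosen so that
`b + a` determines `b` and `a` (`exists_injective_sum`), any compact relation between them can be
realized by a choice of `A`; the relation "last hit" is compact (`exists_hull_realizing_lastHit`).

*Multiplicity.* Add all copies of the hull that contain no point `pt d`, and those that contain a
single one, provided that this point is in fewer than `κ` of the sets `H α n`. A unit ball contains
continuum many copies through any given point of its boundary
(`mk_le_mk_copies_in_closedBall`). A point that is not of the form `pt d` is on the boundary of a
unit ball that misses all of them (`exists_closedBall_disjoint`), and the reflection of the unit ball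
at its tangent at `pt d` contains no other such point.
-/

open Set

/-! ### Branches of the binary tree and the forcing that separates them -/

/-- The nodes of the full binary tree: finite binary sequences, the first component being the
length. -/
abbrev TreeNode : Type := Σ m : ℕ, (Fin m → Bool)

/-- The node of length `m` on the branch `α`. -/
def branchNode (α : ℕ → Bool) (m : ℕ) : TreeNode := ⟨m, fun i => α i⟩

/-- The level `n` is the last one at which the branch `α` meets the set of nodes with indicator
function `d`. -/
def LastHit (d : TreeNode → Bool) (α : ℕ → Bool) (n : ℕ) : Prop :=
  d (branchNode α n) = true ∧ ∀ m, n < m → d (branchNode α m) = false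

theorem LastHit.unique {d : TreeNode → Bool} {α : ℕ → Bool} {n m : ℕ} (hn : LastHit d α n)
    (hm : LastHit d α m) : n = m := by
  rcases lt_trichotomy n m with h | h | h
  · have := hn.2 m h
    rw [hm.1] at this
    cases this
  · exact h
  · have := hm.2 n h
    rw [hn.1] at this
    cases this

theorem isClosed_setOf_branchNode_eq (m : ℕ) (b : Bool) :
    IsClosed {x : (TreeNode → Bool) × (ℕ → Bool) | x.1 (branchNode x.2 m) = b} := by
  have : {x : (TreeNode → Bool) × (ℕ → Bool) | x.1 (branchNode x.2 m) = b} =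
      ⋂ s : Fin m → Bool, {x | (fun i : Fin m => x.2 i) ≠ s} ∪ {x | x.1 ⟨m, s⟩ = b} := by
    ext x
    simp only [mem_ofPred_eq, mem_iInter, mem_union, branchNode]
    constructor
    · intro h s
      by_cases hs : (fun i : Fin m => x.2 i) = s
      · exact Or.inr (hs ▸ h)
      · exact Or.inl hs
    · intro h
      exact (h _).resolve_left (fun h => h rfl)
  rw [this]
  refine isClosed_iInter fun s => IsClosed.union ?_ ?_
  · have hc : Continuous fun x : (TreeNode → Bool) × (ℕ → Bool) => (fun i : Fin m => x.2 i) := by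
      fun_prop
    exact (isClosed_discrete {s}ᶜ).preimage hc
  · have hc : Continuous fun x : (TreeNode → Bool) × (ℕ → Bool) => x.1 ⟨m, s⟩ := by fun_prop
    exact (isClosed_discrete {b}).preimage hc

theorem isClosed_setOf_lastHit (n : ℕ) :
    IsClosed {x : (TreeNode → Bool) × (ℕ → Bool) | LastHit x.1 x.2 n} := by
  simp only [LastHit, ofPred_and, ofPred_forall]
  exact (isClosed_setOf_branchNode_eq n true).inter
    (isClosed_iInter fun m => isClosed_iInter fun _ => isClosed_setOf_branchNode_eq m false)

theorem branchNode_inj {α β : ℕ → Bool} {n m : ℕ} (h : branchNode α n = branchNode β m) :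
    n = m ∧ ∀ i < n, α i = β i := by
  simp only [branchNode, Sigma.mk.injEq] at h
  obtain ⟨rfl, h⟩ := h
  exact ⟨rfl, fun i hi => congrFun (eq_of_heq h) ⟨i, hi⟩⟩

/-- High up on a branch, one finds nodes off any finite set of other branches. -/
theorem exists_branchNode_fresh (α : ℕ → Bool) (s : Finset TreeNode) (F : Finset (ℕ → Bool)) :
    ∃ N, ∀ n ≥ N, (∀ β ∈ F, β ≠ α → ∀ m, branchNode α n ≠ branchNode β m) ∧ ∀ x ∈ s, x.1 < n := by
  rw [← Filter.eventually_atTop]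
  refine Filter.Eventually.and ?_ ?_
  · rw [Filter.eventually_all_finset]
    intro β _
    by_cases h : β = α
    · exact Filter.Eventually.of_forall fun n h' => absurd h h'
    · obtain ⟨i, hi⟩ := Function.ne_iff.mp h
      filter_upwards [Filter.eventually_gt_atTop i] with n hn _ m h
      exact hi ((branchNode_inj h).2 i hn).symm
  · rw [Filter.eventually_all_finset]
    intro x _
    exact Filter.eventually_gt_atTop _

/-- Conditions of the forcing that adds a set of nodes from a colour `f ⊆ (branches) × ℕ`: a finite
part `nodes` of the set, and finitely many `frozen` branches which the set shall not meet any
further. A branch may be frozen only if it has infinitely many levels of the colour `f`, and if the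
last level at which it meets the finite part has this colour. -/
structure FreezingCondition (f : (ℕ → Bool) → ℕ → Prop) where
  /-- The finite part of the set of nodes that is decided to lie in it. -/
  nodes : Finset TreeNode
  /-- The branches which receive no further nodes. -/
  frozen : Finset (ℕ → Bool)
  good : ∀ α ∈ frozen, (∀ N, ∃ n ≥ N, f α n) ∧
    ∃ n, f α n ∧ branchNode α n ∈ nodes ∧ ∀ m, n < m → branchNode α m ∉ nodes

namespace FreezingCondition

variable {f : (ℕ → Bool) → ℕ → Prop}

@[ext]
theorem ext {p q : FreezingCondition f} (h : p.nodes = q.nodes) (h' : p.frozen = q.frozen) :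
    p = q := by
  cases p; cases q; cases h; cases h'; rfl

instance : PartialOrder (FreezingCondition f) where
  le q p := p.nodes ⊆ q.nodes ∧ p.frozen ⊆ q.frozen ∧
    ∀ α ∈ p.frozen, ∀ m, branchNode α m ∈ q.nodes → branchNode α m ∈ p.nodes
  le_refl p := ⟨subset_rfl, subset_rfl, fun _ _ _ h => h⟩
  le_trans r q p h h' := ⟨h'.1.trans h.1, h'.2.1.trans h.2.1, fun α hα m hm =>
    h'.2.2 α hα m (h.2.2 α (h'.2.1 hα) m hm)⟩
  le_antisymm p q h h' := ext (h'.1.antisymm h.1) (h'.2.1.antisymm h.2.1)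

theorem le_def {p q : FreezingCondition f} : q ≤ p ↔ p.nodes ⊆ q.nodes ∧ p.frozen ⊆ q.frozen ∧
    ∀ α ∈ p.frozen, ∀ m, branchNode α m ∈ q.nodes → branchNode α m ∈ p.nodes := Iff.rfl

instance : Nonempty (FreezingCondition f) := ⟨⟨∅, ∅, by simp⟩⟩

/-- Conditions with the same finite part are compatible: freeze all their branches. -/
theorem isSigmaCentered : IsSigmaCentered (FreezingCondition f) := by
  classical
  refine ⟨fun k => {p | Encodable.encode p.nodes = k}, ?_, ?_⟩
  · exact eq_univ_of_forall fun p => mem_iUnion.mpr ⟨Encodable.encode p.nodes, rfl⟩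
  · intro k S hS
    rcases S.eq_empty_or_nonempty with rfl | ⟨p₀, hp₀⟩
    · exact ⟨Classical.arbitrary _, by simp⟩
    have hn : ∀ p ∈ S, p.nodes = p₀.nodes := fun p hp =>
      Encodable.encode_injective ((hS hp).trans (hS hp₀).symm)
    refine ⟨⟨p₀.nodes, S.biUnion frozen, ?_⟩, ?_⟩
    · intro α hα
      obtain ⟨p, hp, hα⟩ := Finset.mem_biUnion.mp hα
      exact hn p hp ▸ p.good α hα
    · intro p hp
      exact ⟨(hn p hp).le, Finset.subset_biUnion_of_mem frozen hp,
        fun α _ m hm => (hn p hp) ▸ hm⟩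

open Classical in
/-- A node off the frozen branches may be added, and its branch frozen. -/
theorem exists_extension (p : FreezingCondition f) {α : ℕ → Bool} (hα : α ∉ p.frozen) {n : ℕ}
    (hn : ∀ β ∈ p.frozen, β ≠ α → ∀ m, branchNode α n ≠ branchNode β m)
    (hs : ∀ x ∈ p.nodes, x.1 < n) :
    ∃ q ≤ p, branchNode α n ∈ q.nodes ∧ ((∀ N, ∃ n ≥ N, f α n) → f α n → α ∈ q.frozen) := by
  have hne : ∀ β ∈ p.frozen, β ≠ α := fun β hβ h => hα (h ▸ hβ)
  have key : ∀ β ∈ p.frozen, ∀ m,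
      branchNode β m ∈ insert (branchNode α n) p.nodes → branchNode β m ∈ p.nodes := by
    intro β hβ m hm
    exact (Finset.mem_insert.mp hm).resolve_left fun h => hn β hβ (hne β hβ) m h.symm
  have old : ∀ β ∈ p.frozen, (∀ N, ∃ n ≥ N, f β n) ∧ ∃ k, f β k ∧
      branchNode β k ∈ insert (branchNode α n) p.nodes ∧
      ∀ m, k < m → branchNode β m ∉ insert (branchNode α n) p.nodes := by
    intro β hβ
    obtain ⟨h, k, hk, hk', hk''⟩ := p.good β hβ
    exact ⟨h, k, hk, Finset.mem_insert_of_mem hk', fun m hm h => hk'' m hm (key β hβ m h)⟩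
  by_cases hf : (∀ N, ∃ n ≥ N, f α n) ∧ f α n
  · refine ⟨⟨insert (branchNode α n) p.nodes, insert α p.frozen, ?_⟩,
      ⟨Finset.subset_insert _ _, Finset.subset_insert _ _, key⟩, Finset.mem_insert_self _ _,
      fun _ _ => Finset.mem_insert_self _ _⟩
    intro β hβ
    rcases Finset.mem_insert.mp hβ with rfl | hβ
    · refine ⟨hf.1, n, hf.2, Finset.mem_insert_self _ _, fun m hm h => ?_⟩
      rcases Finset.mem_insert.mp h with h | h
      · exact hm.ne' (branchNode_inj h).1
      · exact hm.asymm (hs _ h)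
    · exact old β hβ
  · exact ⟨⟨insert (branchNode α n) p.nodes, p.frozen, old⟩,
      ⟨Finset.subset_insert _ _, subset_rfl, key⟩, Finset.mem_insert_self _ _,
      fun h h' => absurd ⟨h, h'⟩ hf⟩

/-- The dense sets: a branch with infinitely many levels of the colour `f` gets frozen, any other
branch is met at arbitrarily high levels. -/
def denseSet (f : (ℕ → Bool) → ℕ → Prop) (α : ℕ → Bool) (k : ℕ) : Set (FreezingCondition f) :=
  {p | ((∀ N, ∃ n ≥ N, f α n) → α ∈ p.frozen) ∧
    ((¬ ∀ N, ∃ n ≥ N, f α n) → ∃ m ≥ k, branchNode α m ∈ p.nodes)}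

theorem isForcingDense_denseSet (α : ℕ → Bool) (k : ℕ) : IsForcingDense (denseSet f α k) := by
  intro p
  by_cases hα : α ∈ p.frozen
  · exact ⟨p, ⟨fun _ => hα, fun h => absurd (p.good α hα).1 h⟩, le_rfl⟩
  obtain ⟨N, hN⟩ := exists_branchNode_fresh α p.nodes p.frozen
  by_cases hf : ∀ N, ∃ n ≥ N, f α n
  · obtain ⟨n, hn, hfn⟩ := hf N
    obtain ⟨q, hq, -, hq'⟩ := p.exists_extension hα (hN n hn).1 (hN n hn).2
    exact ⟨q, ⟨fun _ => hq' hf hfn, fun h => absurd hf h⟩, hq⟩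
  · have hn : max N k ≥ N := le_max_left _ _
    obtain ⟨q, hq, hq', -⟩ := p.exists_extension hα (hN _ hn).1 (hN _ hn).2
    exact ⟨q, ⟨fun h => absurd h hf, fun _ => ⟨_, le_max_right _ _, hq'⟩⟩, hq⟩

end FreezingCondition

open FreezingCondition in
/-- Given at most `κ` branches and a colour `f`, some set of nodes meets each branch with infinitely
many levels of the colour `f` for the last time at such a level, and meets all other branches
infinitely often. -/
theorem MASigmaCentered.exists_lastHit {κ : Cardinal.{0}} (hMA : MASigmaCentered κ)
    (hκ : Cardinal.aleph0 ≤ κ) (T : Set (ℕ → Bool)) (hT : Cardinal.mk T ≤ κ)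
    (f : (ℕ → Bool) → ℕ → Prop) :
    ∃ d : TreeNode → Bool, ∀ α ∈ T, ((∀ N, ∃ n ≥ N, f α n) → ∃ n, LastHit d α n) ∧
      ∀ n, LastHit d α n → f α n := by
  classical
  obtain ⟨G, hG⟩ := hMA (FreezingCondition f) isSigmaCentered
    (range fun x : T × ℕ => denseSet f x.1 x.2) (by
      refine Cardinal.mk_range_le.trans ?_
      rw [Cardinal.mk_prod, Cardinal.lift_id, Cardinal.lift_id, Cardinal.mk_nat]
      exact (mul_le_mul' hT hκ).trans (Cardinal.mul_eq_self hκ).le)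
    (by rintro _ ⟨x, rfl⟩; exact isForcingDense_denseSet _ _)
  have hG' : ∀ α ∈ T, ∀ k, ∃ p ∈ denseSet f α k, p ∈ G := fun α hα k =>
    hG _ ⟨(⟨α, hα⟩, k), rfl⟩
  refine ⟨fun x => decide (∃ p ∈ G, x ∈ p.nodes), fun α hα => ?_⟩
  by_cases hf : ∀ N, ∃ n ≥ N, f α n
  · obtain ⟨p, hp, hpG⟩ := hG' α hα 0
    have hαp := hp.1 hf
    obtain ⟨-, n, hfn, hn, hn'⟩ := p.good α hαp
    have hlast : LastHit (fun x => decide (∃ p ∈ G, x ∈ p.nodes)) α n := by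
      refine ⟨decide_eq_true ⟨p, hpG, hn⟩, fun m hm => decide_eq_false ?_⟩
      rintro ⟨q, hqG, hq⟩
      obtain ⟨r, -, hrp, hrq⟩ := G.directed p hpG q hqG
      exact hn' m hm ((le_def.mp hrp).2.2 α hαp m ((le_def.mp hrq).1 hq))
    exact ⟨fun _ => ⟨n, hlast⟩, fun k hk => hk.unique hlast ▸ hfn⟩
  · refine ⟨fun h => absurd h hf, fun n hn => ?_⟩
    obtain ⟨p, hp, hpG⟩ := hG' α hα (n + 1)
    obtain ⟨m, hm, hmp⟩ := hp.2 hf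
    have := hn.2 m hm
    exact absurd ⟨p, hpG, hmp⟩ (of_decide_eq_false this)

/-! ### Coding pairs of binary functions by sums of reals -/

theorem continuous_cantorFunction {c : ℝ} (h0 : 0 ≤ c) (h1 : c < 1) :
    Continuous (Cardinal.cantorFunction c) := by
  unfold Cardinal.cantorFunction
  refine continuous_tsum (u := fun n => c ^ n) (fun n => ?_) (summable_geometric_of_lt_one h0 h1)
    fun n f => ?_
  · have : Continuous fun b : Bool => cond b (c ^ n) 0 := continuous_of_discreteTopology
    exact this.comp (continuous_apply n)
  · cases h : f n <;> simp [Cardinal.cantorFunctionAux, h, abs_of_nonneg h0, pow_nonneg h0]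

theorem cantorFunction_nonneg {c : ℝ} (h0 : 0 ≤ c) (f : ℕ → Bool) :
    0 ≤ Cardinal.cantorFunction c f :=
  tsum_nonneg fun _ => Cardinal.cantorFunctionAux_nonneg h0

theorem cantorFunction_le_inv {c : ℝ} (h0 : 0 ≤ c) (h1 : c < 1) (f : ℕ → Bool) :
    Cardinal.cantorFunction c f ≤ (1 - c)⁻¹ := by
  rw [← tsum_geometric_of_lt_one h0 h1]
  refine (Cardinal.summable_cantor_function f h0 h1).tsum_le_tsum (fun n => ?_)
    (summable_geometric_of_lt_one h0 h1)
  cases h : f n <;> simp [h, pow_nonneg h0]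

/-- Two Cantor sets of reals can be chosen so that a sum of an element of one and an element of the
other determines both summands. -/
theorem exists_injective_sum (I J : Type) [Countable I] [Countable J] [Infinite I] :
    ∃ (a : (I → Bool) → ℝ) (b : (J → Bool) → ℝ), Continuous a ∧ Continuous b ∧
      (∀ x, a x ∈ Icc 0 (3 / 2)) ∧ (∀ y, b y ∈ Icc 0 (3 / 2)) ∧
      (∀ x y, b y + a x ∈ Icc 0 (3 / 2)) ∧
      ∀ x y x' y', b y + a x = b y' + a x' → x = x' ∧ y = y' := by
  obtain ⟨e⟩ := (inferInstance : Nonempty (I ⊕ J ≃ ℕ))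
  have h0 : (0 : ℝ) ≤ 1 / 3 := by norm_num
  have h1 : (1 / 3 : ℝ) < 1 := by norm_num
  -- the digits of the sum, placed by `e`, are those of `x` and those of `y`
  let F : (I ⊕ J → Bool) → ℝ := fun g => Cardinal.cantorFunction (1 / 3) (g ∘ e.symm)
  have hF : Continuous F := (continuous_cantorFunction h0 h1).comp (by fun_prop)
  have hF' : ∀ g, F g ∈ Icc 0 (3 / 2) := fun g =>
    ⟨cantorFunction_nonneg h0 _, (cantorFunction_le_inv h0 h1 _).trans (by norm_num)⟩
  have hinj : Function.Injective F := fun g g' h => by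
    have := Cardinal.cantorFunction_injective (by norm_num) (by norm_num) h
    exact e.symm.surjective.injective_comp_right this
  have hadd : ∀ x y, F (Sum.elim (fun _ => false) y) + F (Sum.elim x fun _ => false) =
      F (Sum.elim x y) := by
    intro x y
    simp only [F, Cardinal.cantorFunction]
    rw [← Summable.tsum_add (Cardinal.summable_cantor_function _ h0 h1)
      (Cardinal.summable_cantor_function _ h0 h1)]
    congr 1 with n
    simp only [Cardinal.cantorFunctionAux, Function.comp]
    rcases e.symm n with i | j <;> simp
  refine ⟨fun x => F (Sum.elim x fun _ => false), fun y => F (Sum.elim (fun _ => false) y),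
    hF.comp ?_, hF.comp ?_, fun _ => hF' _, fun _ => hF' _, fun x y => hadd x y ▸ hF' _, ?_⟩
  · refine continuous_pi ?_
    rintro (i | j)
    · exact continuous_apply i
    · exact continuous_const
  · refine continuous_pi ?_
    rintro (i | j)
    · exact continuous_const
    · exact continuous_apply j
  · intro x y x' y' h
    rw [hadd, hadd] at h
    have h := hinj h
    exact ⟨funext fun i => congrFun h (Sum.inl i), funext fun j => congrFun h (Sum.inr j)⟩

/-! ### Convex hulls of subsets of an arc, and their copies -/

theorem IsIsometricCopy.isClosed {X : Type} [MetricSpace X] {H C : Set X}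
    (h : IsIsometricCopy H C) (hC : IsCompact C) :
    IsClosed H := by
  obtain ⟨f, rfl⟩ := h
  exact (hC.image f.continuous).isClosed

section Geometry

variable {E : Type} [NormedAddCommGroup E] [InnerProductSpace ℝ E]

/-- The point with angle `θ` on the unit circle of the plane spanned by the orthonormal vectors `u`
and `v`. -/
noncomputable def circlePoint (u v : E) (θ : ℝ) : E := Real.cos θ • u + Real.sin θ • v

/-- The reflection in the line of angle `t / 2`; it exchanges the angles `θ` and `t - θ`. -/
noncomputable def circleFlip (u v : E) (t : ℝ) : E ≃ₗᵢ[ℝ] E :=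
  (Submodule.span ℝ {circlePoint u v (t / 2)}).reflection

/-- The closed convex hull of the points of the unit circle with angle in `A`. -/
noncomputable def arcHull (u v : E) (A : Set ℝ) : Set E :=
  closure (convexHull ℝ (circlePoint u v '' A))

theorem continuous_circlePoint (u v : E) : Continuous (circlePoint u v) := by
  unfold circlePoint
  fun_prop

theorem inner_circlePoint {u v : E} (hu : ‖u‖ = 1) (hv : ‖v‖ = 1) (huv : inner ℝ u v = 0)
    (x y : ℝ) : inner ℝ (circlePoint u v x) (circlePoint u v y) = Real.cos (x - y) := by
  have hvu : inner ℝ v u = 0 := by rw [real_inner_comm, huv]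
  simp only [circlePoint, inner_add_left, inner_add_right, real_inner_smul_left,
    real_inner_smul_right, real_inner_self_eq_norm_sq, hu, hv, huv, hvu, Real.cos_sub]
  ring

theorem norm_circlePoint {u v : E} (hu : ‖u‖ = 1) (hv : ‖v‖ = 1) (huv : inner ℝ u v = 0) (x : ℝ) :
    ‖circlePoint u v x‖ = 1 := by
  have h := inner_circlePoint hu hv huv x x
  rw [real_inner_self_eq_norm_sq, sub_self, Real.cos_zero] at h
  exact (pow_eq_one_iff_of_nonneg (norm_nonneg _) two_ne_zero).mp h

theorem circlePoint_inj {u v : E} (hu : ‖u‖ = 1) (hv : ‖v‖ = 1) (huv : inner ℝ u v = 0) {x y : ℝ}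
    (h : circlePoint u v x = circlePoint u v y) (hxy : |x - y| < 6) : x = y := by
  have h' := inner_circlePoint hu hv huv x y
  rw [h, real_inner_self_eq_norm_sq, norm_circlePoint hu hv huv] at h'
  have hpi := Real.pi_gt_three
  obtain ⟨h1, h2⟩ := abs_lt.mp hxy
  have := (Real.cos_eq_one_iff_of_lt_of_lt (x := x - y) (by linarith) (by linarith)).mp
    (by linarith)
  linarith

theorem circleFlip_circlePoint {u v : E} (hu : ‖u‖ = 1) (hv : ‖v‖ = 1) (huv : inner ℝ u v = 0)
    (t x : ℝ) : circleFlip u v t (circlePoint u v x) = circlePoint u v (t - x) := by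
  rw [circleFlip, Submodule.reflection_singleton_apply, inner_circlePoint hu hv huv,
    norm_circlePoint hu hv huv]
  have h1 : Real.cos (t - x) = 2 * Real.cos (t / 2 - x) * Real.cos (t / 2) - Real.cos x := by
    have key : ∀ y z, Real.cos (y + z) = 2 * Real.cos y * Real.cos z - Real.cos (z - y) := by
      intro y z
      rw [Real.cos_add, Real.cos_sub]
      ring
    convert key (t / 2 - x) (t / 2) using 2 <;> ring_nf
  have h2 : Real.sin (t - x) = 2 * Real.cos (t / 2 - x) * Real.sin (t / 2) - Real.sin x := by
    have key : ∀ y z, Real.sin (y + z) = 2 * Real.cos y * Real.sin z - Real.sin (z - y) := by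
      intro y z
      rw [Real.sin_add, Real.sin_sub]
      ring
    convert key (t / 2 - x) (t / 2) using 2 <;> ring_nf
  simp only [circlePoint, h1, h2]
  simp only [RCLike.ofReal_one, one_pow, div_one]
  module

theorem circleFlip_circleFlip (u v : E) (t : ℝ) (x : E) :
    circleFlip u v t (circleFlip u v t x) = x := Submodule.reflection_reflection _ x

theorem closure_convexHull_subset {S K : Set E} (hK : Convex ℝ K) (hK' : IsClosed K)
    (h : S ⊆ K) : closure (convexHull ℝ S) ⊆ K :=
  closure_minimal (convexHull_min h hK) hK'

theorem closure_convexHull_subset_closedBall {S : Set E} (hS : ∀ s ∈ S, ‖s‖ = 1) :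
    closure (convexHull ℝ S) ⊆ Metric.closedBall 0 1 :=
  closure_convexHull_subset (convex_closedBall _ _) Metric.isClosed_closedBall fun s hs => by
    simp [hS s hs]

theorem le_inner_of_mem_closure_convexHull {S : Set E} {y : E} {c : ℝ}
    (hS : ∀ s ∈ S, c ≤ inner ℝ s y) {x : E} (hx : x ∈ closure (convexHull ℝ S)) :
    c ≤ inner ℝ x y := by
  refine closure_convexHull_subset (K := {x | c ≤ inner ℝ x y}) ?_ ?_ hS hx
  · refine convex_halfSpace_ge (𝕜 := ℝ) ⟨fun a b => inner_add_left _ _ _, fun a b => ?_⟩ c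
    simp [real_inner_smul_left]
  · exact isClosed_le continuous_const (by fun_prop)

/-- A closed convex hull of a compact subset of the unit sphere contains no other points of the
sphere. -/
theorem mem_of_mem_closure_convexHull {S : Set E} (hS : IsCompact S) (h1 : ∀ s ∈ S, ‖s‖ = 1)
    {y : E} (hy : ‖y‖ = 1) (hyS : y ∈ closure (convexHull ℝ S)) : y ∈ S := by
  have hne : S.Nonempty := by
    by_contra h
    rw [not_nonempty_iff_eq_empty.mp h] at hyS
    simp at hyS
  obtain ⟨s, hs, hmax⟩ := hS.exists_isMaxOn hne
    (f := fun s => inner ℝ s y) (by fun_prop)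
  have h2 : -inner ℝ s y ≤ inner ℝ y (-y) :=
    le_inner_of_mem_closure_convexHull (S := S) (y := -y) (fun r hr => by
      rw [inner_neg_right, neg_le_neg_iff]; exact hmax hr) hyS
  rw [inner_neg_right, real_inner_self_eq_norm_sq, hy] at h2
  have h3 := real_inner_le_norm s y
  rw [h1 s hs, hy] at h3
  have : s = y := (inner_eq_one_iff_of_norm_eq_one (𝕜 := ℝ) (h1 s hs) hy).mp (by linarith)
  exact this ▸ hs

theorem convex_arcHull (u v : E) (A : Set ℝ) : Convex ℝ (arcHull u v A) :=
  (convex_convexHull ℝ _).closure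

theorem circlePoint_mem_arcHull (u v : E) {A : Set ℝ} {x : ℝ} (hx : x ∈ A) :
    circlePoint u v x ∈ arcHull u v A :=
  subset_closure (subset_convexHull ℝ _ (mem_image_of_mem _ hx))

theorem norm_le_of_mem_arcHull {u v : E} (hu : ‖u‖ = 1) (hv : ‖v‖ = 1) (huv : inner ℝ u v = 0)
    {A : Set ℝ} {x : E} (hx : x ∈ arcHull u v A) : ‖x‖ ≤ 1 := by
  have := closure_convexHull_subset_closedBall
    (by rintro _ ⟨θ, -, rfl⟩; exact norm_circlePoint hu hv huv θ) hx
  simpa using this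

theorem isCompact_arcHull [FiniteDimensional ℝ E] {u v : E} (hu : ‖u‖ = 1) (hv : ‖v‖ = 1)
    (huv : inner ℝ u v = 0) (A : Set ℝ) : IsCompact (arcHull u v A) :=
  have := FiniteDimensional.proper ℝ E
  (isCompact_closedBall (0 : E) 1).of_isClosed_subset isClosed_closure
    fun _ hx => by simpa using norm_le_of_mem_arcHull hu hv huv hx

theorem mem_arcHull_iff {u v : E} (hu : ‖u‖ = 1) (hv : ‖v‖ = 1) (huv : inner ℝ u v = 0)
    {A : Set ℝ} (hA : IsCompact A) (hA' : A ⊆ Icc 0 (3 / 2)) {x : ℝ} (hx : |x| ≤ 4) :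
    circlePoint u v x ∈ arcHull u v A ↔ x ∈ A := by
  refine ⟨fun h => ?_, circlePoint_mem_arcHull u v⟩
  obtain ⟨a, ha, hax⟩ := mem_of_mem_closure_convexHull (hA.image (continuous_circlePoint u v))
    (by rintro _ ⟨θ, -, rfl⟩; exact norm_circlePoint hu hv huv θ)
    (norm_circlePoint hu hv huv x) h
  have h1 := hA' ha
  have h2 := abs_le.mp hx
  have : a = x := circlePoint_inj hu hv huv hax (by
    rw [abs_lt]; constructor <;> linarith [h1.1, h1.2, h2.1, h2.2])
  exact this ▸ ha

theorem mem_circleFlip_arcHull_iff {u v : E} (hu : ‖u‖ = 1) (hv : ‖v‖ = 1)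
    (huv : inner ℝ u v = 0) {A : Set ℝ} (hA : IsCompact A) (hA' : A ⊆ Icc 0 (3 / 2)) {t x : ℝ}
    (hx : |t - x| ≤ 4) :
    circlePoint u v x ∈ circleFlip u v t '' arcHull u v A ↔ t - x ∈ A := by
  rw [← mem_arcHull_iff hu hv huv hA hA' hx, ← circleFlip_circlePoint hu hv huv]
  constructor
  · rintro ⟨y, hy, h⟩
    rwa [← h, circleFlip_circleFlip]
  · exact fun h => ⟨_, h, circleFlip_circleFlip _ _ _ _⟩

/-- A subset of a short arc has no rotational symmetry: the flip is determined by the set to which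
it takes the hull. -/
theorem circleFlip_arcHull_inj {u v : E} (hu : ‖u‖ = 1) (hv : ‖v‖ = 1)
    (huv : inner ℝ u v = 0) {A : Set ℝ} (hA : IsCompact A) (hA' : A ⊆ Icc 0 (3 / 2))
    (hne : A.Nonempty) {s t : ℝ} (hs : s ∈ Icc (0 : ℝ) (3 / 2)) (ht : t ∈ Icc (0 : ℝ) (3 / 2))
    (h : circleFlip u v s '' arcHull u v A = circleFlip u v t '' arcHull u v A) : s = t := by
  have key : ∀ s ∈ Icc (0 : ℝ) (3 / 2), ∀ t ∈ Icc (0 : ℝ) (3 / 2),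
      circleFlip u v s '' arcHull u v A = circleFlip u v t '' arcHull u v A → t ≤ s := by
    intro s hs t ht h
    obtain ⟨m, hm, hmax⟩ := hA.exists_isGreatest hne
    have hm' := hA' hm
    have h1 : circlePoint u v (s - m) ∈ circleFlip u v s '' arcHull u v A := by
      rw [mem_circleFlip_arcHull_iff hu hv huv hA hA'] <;> rw [sub_sub_cancel]
      · exact hm
      · rw [abs_le]; constructor <;> linarith [hm'.1, hm'.2]
    rw [h, mem_circleFlip_arcHull_iff hu hv huv hA hA'] at h1
    · linarith [hmax h1]
    · rw [abs_le]; constructor <;> linarith [hm'.1, hm'.2, hs.1, hs.2, ht.1, ht.2]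
  exact le_antisymm (key t ht s hs h.symm) (key s hs t ht h)

/-- A fan of copies: for every angle in `A`, the hull can be moved into a given unit ball so that
the vertex with this angle goes to a given point of the boundary. -/
theorem mk_le_mk_copies_in_closedBall {u v : E} (hu : ‖u‖ = 1) (hv : ‖v‖ = 1)
    (huv : inner ℝ u v = 0) {A : Set ℝ} (hA : IsCompact A) (hA' : A ⊆ Icc 0 (3 / 2))
    {q x : E} (hx : ‖x - q‖ = 1) :
    Cardinal.mk A ≤ Cardinal.mk {H : Set E // IsIsometricCopy H (arcHull u v A) ∧
      H ⊆ Metric.closedBall q 1 ∧ x ∈ H} := by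
  rcases A.eq_empty_or_nonempty with rfl | hne
  · simp
  obtain ⟨R, hR⟩ : ∃ R : E ≃ₗᵢ[ℝ] E, R (circlePoint u v 0) = x - q :=
    ⟨_, Submodule.reflection_sub ((norm_circlePoint hu hv huv 0).trans hx.symm)⟩
  let g : ℝ → E ≃ᵢ E := fun t =>
    ((circleFlip u v t).toIsometryEquiv.trans R.toIsometryEquiv).trans (IsometryEquiv.addLeft q)
  have hg : ∀ t y, g t y = q + R (circleFlip u v t y) := fun t y => rfl
  refine Cardinal.mk_le_of_injective (f := fun a : A =>
    ⟨g a '' arcHull u v A, ⟨g a, rfl⟩, ?_, ?_⟩) ?_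
  · rintro _ ⟨y, hy, rfl⟩
    rw [hg, mem_closedBall_iff_norm, add_sub_cancel_left, R.norm_map, LinearIsometryEquiv.norm_map]
    exact norm_le_of_mem_arcHull hu hv huv hy
  · refine ⟨circlePoint u v a, circlePoint_mem_arcHull u v a.2, ?_⟩
    rw [hg, circleFlip_circlePoint hu hv huv, sub_self, hR, add_sub_cancel]
  · intro a b hab
    have h : g a '' arcHull u v A = g b '' arcHull u v A := congrArg Subtype.val hab
    have h' : ∀ t, g t '' arcHull u v A =
        (fun y => q + R y) '' (circleFlip u v t '' arcHull u v A) := fun t => by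
      rw [image_image]; rfl
    rw [h', h'] at h
    have hinj : Function.Injective fun y => q + R y := fun y z hyz =>
      R.injective (add_left_cancel hyz)
    exact Subtype.ext (circleFlip_arcHull_inj hu hv huv hA hA' hne (hA' a.2) (hA' b.2)
      (hinj.image_injective h))

/-- If the points of a compact part `P` of the unit sphere make acute angles with each other, then
every point off `P` lies on the boundary of a unit ball that misses `P`. -/
theorem exists_closedBall_disjoint [FiniteDimensional ℝ E] {P : Set E} (hP : IsCompact P)
    (hne : P.Nonempty) (h1 : ∀ p ∈ P, ‖p‖ = 1) {c : ℝ} (hc : 0 < c)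
    (hP' : ∀ p ∈ P, ∀ p' ∈ P, c ≤ inner ℝ p p') {x : E} (hx : x ∉ P) :
    ∃ q : E, ‖x - q‖ = 1 ∧ ∀ p ∈ P, p ∉ Metric.closedBall q 1 := by
  by_cases hxP : x ∈ closure (convexHull ℝ P)
  · -- the ball touches the unit sphere from inside, on the other side of the origin
    have hpos : ∀ p ∈ P, 0 < inner ℝ x p := fun p hp =>
      hc.trans_le (le_inner_of_mem_closure_convexHull (fun s hs => hP' s hs p hp) hxP)
    have hx0 : 0 < ‖x‖ := by
      rw [norm_pos_iff]
      rintro rfl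
      obtain ⟨p, hp⟩ := hne
      simpa using hpos p hp
    have hx1 : ‖x‖ < 1 := by
      refine lt_of_le_of_ne ?_ fun h => hx (mem_of_mem_closure_convexHull hP h1 h hxP)
      simpa using closure_convexHull_subset_closedBall h1 hxP
    refine ⟨x - ‖x‖⁻¹ • x, ?_, fun p hp hpq => ?_⟩
    · rw [sub_sub_cancel, norm_smul, norm_inv, norm_norm, inv_mul_cancel₀ hx0.ne']
    · rw [mem_closedBall_iff_norm] at hpq
      have e : p - (x - ‖x‖⁻¹ • x) = p + (‖x‖⁻¹ - 1) • x := by module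
      have hk : 0 < ‖x‖⁻¹ - 1 := sub_pos.mpr ((one_lt_inv₀ hx0).mpr hx1)
      have h2 : ‖p + (‖x‖⁻¹ - 1) • x‖ ^ 2 ≤ 1 := by
        rw [← e]; exact pow_le_one₀ (norm_nonneg _) hpq
      rw [norm_add_sq_real, h1 p hp, real_inner_smul_right, real_inner_comm] at h2
      have := mul_pos hk (hpos p hp)
      nlinarith [sq_nonneg ‖(‖x‖⁻¹ - 1) • x‖]
  · -- the ball lies in a half-space that misses `P`
    obtain ⟨f, r, hfx, hf⟩ := geometric_hahn_banach_point_closed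
      (convex_convexHull ℝ P).closure isClosed_closure hxP
    let w := (InnerProductSpace.toDual ℝ E).symm f
    have hw : ∀ y, inner ℝ w y = f y := fun y => InnerProductSpace.toDual_symm_apply
    have hlt : ∀ p ∈ P, 0 < inner ℝ w (p - x) := fun p hp => by
      rw [inner_sub_right, hw, hw]
      linarith [hf p (subset_closure (subset_convexHull ℝ _ hp))]
    have hw0 : 0 < ‖w‖ := by
      rw [norm_pos_iff]
      intro h
      obtain ⟨p, hp⟩ := hne
      simpa [h] using hlt p hp
    refine ⟨x - ‖w‖⁻¹ • w, ?_, fun p hp hpq => ?_⟩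
    · rw [sub_sub_cancel, norm_smul, norm_inv, norm_norm, inv_mul_cancel₀ hw0.ne']
    · rw [mem_closedBall_iff_norm] at hpq
      have e : p - (x - ‖w‖⁻¹ • w) = ‖w‖⁻¹ • w + (p - x) := by module
      have h2 : ‖‖w‖⁻¹ • w + (p - x)‖ ^ 2 ≤ 1 := by
        rw [← e]; exact pow_le_one₀ (norm_nonneg _) hpq
      rw [norm_add_sq_real, norm_smul, norm_inv, norm_norm, inv_mul_cancel₀ hw0.ne',
        real_inner_smul_left] at h2
      have := mul_pos (inv_pos.mpr hw0) (hlt p hp)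
      nlinarith [sq_nonneg ‖p - x‖]

/-- Reflecting the unit ball at its tangent at `p` gives a ball that meets the unit sphere only in
`p`. -/
theorem eq_of_mem_closedBall_two_smul {p p' : E} (hp : ‖p‖ = 1) (hp' : ‖p'‖ = 1)
    (h : p' ∈ Metric.closedBall ((2 : ℝ) • p) 1) : p' = p := by
  rw [mem_closedBall_iff_norm] at h
  have h2 : ‖p' - (2 : ℝ) • p‖ ^ 2 ≤ 1 := pow_le_one₀ (norm_nonneg _) h
  rw [norm_sub_sq_real, norm_smul, hp, hp', real_inner_smul_right] at h2
  have h3 := real_inner_le_norm p' p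
  rw [hp, hp'] at h3
  norm_num at h2
  exact (inner_eq_one_iff_of_norm_eq_one (𝕜 := ℝ) hp' hp).mp (by linarith)

end Geometry

/-! ### The set of angles and the cover -/

/-- The pairs coded by the angles of the vertices: a set of nodes, and a branch together with a set
of levels; every one of these levels has to be the last hit of the branch. Only singletons are of
interest as sets of levels, but admitting all sets makes the relation compact. -/
def lastHitRel : Set ((TreeNode → Bool) × (ℕ ⊕ ℕ → Bool)) :=
  {x | ∀ n, x.2 (Sum.inr n) = true → LastHit x.1 (x.2 ∘ Sum.inl) n}

theorem isCompact_lastHitRel : IsCompact lastHitRel := by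
  refine IsClosed.isCompact ?_
  simp only [lastHitRel, ofPred_forall]
  refine isClosed_iInter fun n => ?_
  simp only [imp_iff_not_or, ofPred_or]
  refine IsClosed.union ?_ ?_
  · have hc : Continuous fun x : (TreeNode → Bool) × (ℕ ⊕ ℕ → Bool) => x.2 (Sum.inr n) := by
      fun_prop
    exact (isClosed_discrete {true}ᶜ).preimage hc
  · have hc : Continuous fun x : (TreeNode → Bool) × (ℕ ⊕ ℕ → Bool) => (x.1, x.2 ∘ Sum.inl) := by
      fun_prop
    exact (isClosed_setOf_lastHit n).preimage hc

/-- The code of a branch and a single level. -/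
def levelCode (α : ℕ → Bool) (n : ℕ) : ℕ ⊕ ℕ → Bool := Sum.elim α fun m => decide (m = n)

theorem levelCode_inj {α β : ℕ → Bool} {n m : ℕ} (h : levelCode α n = levelCode β m) :
    α = β ∧ n = m := by
  refine ⟨funext fun i => congrFun h (Sum.inl i), ?_⟩
  have := congrFun h (Sum.inr n)
  simpa [levelCode] using this

theorem mem_lastHitRel_levelCode {d : TreeNode → Bool} {α : ℕ → Bool} {n : ℕ} :
    (d, levelCode α n) ∈ lastHitRel ↔ LastHit d α n := by
  constructor
  · exact fun h => h n (by simp [levelCode])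
  · intro h m hm
    have : m = n := by simpa [levelCode] using hm
    exact this ▸ h

/-- A family of copies of a single hull which has a copy for each branch and level, and a compact
set of points of the unit sphere, one for each set of nodes, so that incidence means that the level
is the last hit. -/
theorem exists_hull_realizing_lastHit {E : Type} [NormedAddCommGroup E] [InnerProductSpace ℝ E]
    {u v : E} (hu : ‖u‖ = 1) (hv : ‖v‖ = 1) (huv : inner ℝ u v = 0) :
    ∃ (A : Set ℝ) (pt : (TreeNode → Bool) → E) (H : (ℕ → Bool) → ℕ → Set E),
      IsCompact A ∧ A ⊆ Icc 0 (3 / 2) ∧ 2 ^ Cardinal.aleph0 ≤ Cardinal.mk A ∧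
      Continuous pt ∧ Function.Injective pt ∧ (∀ d, ‖pt d‖ = 1) ∧
      (∃ c > 0, ∀ d d', c ≤ inner ℝ (pt d) (pt d')) ∧
      (∀ α n, IsIsometricCopy (H α n) (arcHull u v A)) ∧
      (∀ α n β m, H α n = H β m → α = β ∧ n = m) ∧
      ∀ d α n, pt d ∈ H α n ↔ LastHit d α n := by
  obtain ⟨a, b, ha, hb, ha', hb', hab, hinj⟩ := exists_injective_sum TreeNode (ℕ ⊕ ℕ)
  let F : (TreeNode → Bool) × (ℕ ⊕ ℕ → Bool) → ℝ := fun x => b x.2 + a x.1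
  have hF : Continuous F := by fun_prop
  have hFinj : Function.Injective F := fun x y h =>
    Prod.ext (hinj _ _ _ _ h).1 (hinj _ _ _ _ h).2
  have hA : IsCompact (F '' lastHitRel) := isCompact_lastHitRel.image hF
  have hA' : F '' lastHitRel ⊆ Icc 0 (3 / 2) := by
    rintro _ ⟨x, -, rfl⟩
    exact hab _ _
  -- with no levels at all, the relation holds vacuously
  have hmem : ∀ (d : TreeNode → Bool) (α : ℕ → Bool),
      F (d, Sum.elim α fun _ => false) ∈ F '' lastHitRel := fun d α =>
    mem_image_of_mem F fun n hn => by simp at hn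
  have habs : ∀ x y : ℝ, x ∈ Icc (0 : ℝ) (3 / 2) → y ∈ Icc (0 : ℝ) (3 / 2) → |x - y| ≤ 3 / 2 := by
    intro x y hx hy
    rw [abs_le]
    constructor <;> linarith [hx.1, hx.2, hy.1, hy.2]
  have hpi := Real.pi_gt_d2
  refine ⟨F '' lastHitRel, fun d => circlePoint u v (-a d),
    fun α n => circleFlip u v (b (levelCode α n)) '' arcHull u v (F '' lastHitRel), hA, hA', ?_,
    (continuous_circlePoint u v).comp ha.neg, ?_, fun d => norm_circlePoint hu hv huv _,
    ⟨Real.cos (3 / 2), Real.cos_pos_of_mem_Ioo ⟨by linarith, by linarith⟩, fun d d' => ?_⟩,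
    fun α n => ⟨(circleFlip u v _).toIsometryEquiv, rfl⟩, ?_, ?_⟩
  · have : Cardinal.mk (ℕ → Bool) = 2 ^ Cardinal.aleph0 := by simp
    rw [← this]
    refine Cardinal.mk_le_of_injective (f := fun α => ⟨_, hmem (fun _ => false) α⟩) ?_
    intro α β h
    have h := (Prod.ext_iff.mp (hFinj (congrArg Subtype.val h))).2
    exact funext fun i => congrFun h (Sum.inl i)
  · intro d d' h
    have h1 := habs _ _ (ha' d') (ha' d)
    have h2 := circlePoint_inj hu hv huv h (by
      rw [neg_sub_neg]; linarith)
    refine (hinj d (fun _ => false) d' (fun _ => false) ?_).1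
    linarith
  · rw [inner_circlePoint hu hv huv, ← Real.cos_abs (-a d - -a d')]
    have h1 := habs _ _ (ha' d') (ha' d)
    refine Real.cos_le_cos_of_nonneg_of_le_pi (abs_nonneg _) (by linarith) ?_
    rwa [neg_sub_neg]
  · intro α n β m h
    have h1 := circleFlip_arcHull_inj hu hv huv hA hA'
      ⟨_, hmem (fun _ => false) fun _ => false⟩ (hb' _) (hb' _) h
    exact levelCode_inj (hinj (fun _ => false) _ (fun _ => false) _ (by rw [h1])).2
  · intro d α n
    have h1 := ha' d
    have h2 := hb' (levelCode α n)
    rw [mem_circleFlip_arcHull_iff hu hv huv hA hA', sub_neg_eq_add,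
      ← mem_lastHitRel_levelCode]
    · exact hFinj.mem_set_image (a := (d, levelCode α n))
    · rw [sub_neg_eq_add, abs_le]
      constructor <;> linarith [h1.1, h1.2, h2.1, h2.2]

/-- The construction works in every finite-dimensional Euclidean space that contains a plane. -/
theorem MASigmaCentered.exists_convex_cover_not_splits {κ : Cardinal.{0}}
    (hMA : MASigmaCentered κ) (hκ : Cardinal.aleph0 ≤ κ) (hκ' : κ < 2 ^ Cardinal.aleph0)
    {E : Type} [NormedAddCommGroup E] [InnerProductSpace ℝ E] [FiniteDimensional ℝ E]
    {u v : E} (hu : ‖u‖ = 1) (hv : ‖v‖ = 1) (huv : inner ℝ u v = 0) :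
    ∃ (C : Set E) (ℋ : Set (Set E)), IsCompact C ∧ Convex ℝ C ∧
      (∀ H ∈ ℋ, IsClosed H ∧ IsIsometricCopy H C) ∧ IsFoldCover κ ℋ ∧
      ¬ SplitsIntoTwoCovers ℋ := by
  obtain ⟨A, pt, H, hA, hA', hAcard, hpt, hptinj, hptnorm, ⟨c, hc, hptc⟩, hcopy, hHinj, hH⟩ :=
    exists_hull_realizing_lastHit hu hv huv
  have hC : IsCompact (arcHull u v A) := isCompact_arcHull hu hv huv A
  obtain ⟨T, hT⟩ : ∃ T : Set (ℕ → Bool), Cardinal.mk T = κ := by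
    refine Cardinal.le_mk_iff_exists_set.mp ?_
    simpa using hκ'.le
  let M : Set (Set E) := {S | ∃ α ∈ T, ∃ n, S = H α n}
  let Full : (TreeNode → Bool) → Prop := fun d =>
    κ ≤ Cardinal.mk {S : Set E // S ∈ M ∧ pt d ∈ S}
  -- the copies that avoid all coded points, and those that contain at most one of them, a point not
  -- yet covered `κ` times
  let N : Set (Set E) := {S | IsIsometricCopy S (arcHull u v A) ∧ ∀ d, pt d ∉ S}
  let N' : Set (Set E) := {S | IsIsometricCopy S (arcHull u v A) ∧
    ∃ d, ¬ Full d ∧ ∀ d', pt d' ∈ S → d' = d}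
  have hall : ∀ S ∈ M ∪ (N ∪ N'), IsIsometricCopy S (arcHull u v A) := by
    rintro S (⟨α, -, n, rfl⟩ | h | h)
    exacts [hcopy α n, h.1, h.1]
  refine ⟨arcHull u v A, M ∪ (N ∪ N'), hC, convex_arcHull u v A,
    fun S hS => ⟨(hall S hS).isClosed hC, hall S hS⟩, ?_, ?_⟩
  · have fan : ∀ q x : E, ‖x - q‖ = 1 →
        (∀ S, IsIsometricCopy S (arcHull u v A) → S ⊆ Metric.closedBall q 1 → S ∈ N ∪ N') →
        κ ≤ Cardinal.mk {S : Set E // S ∈ M ∪ (N ∪ N') ∧ x ∈ S} := by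
      intro q x hx h
      refine (hκ'.le.trans hAcard).trans
        ((mk_le_mk_copies_in_closedBall hu hv huv hA hA' hx).trans ?_)
      exact Cardinal.mk_subtype_mono fun S hS => ⟨Or.inr (h S hS.1 hS.2.1), hS.2.2⟩
    intro x
    by_cases hx : x ∈ range pt
    · obtain ⟨d, rfl⟩ := hx
      by_cases hd : Full d
      · exact hd.trans (Cardinal.mk_subtype_mono fun S hS => ⟨Or.inl hS.1, hS.2⟩)
      · refine fan ((2 : ℝ) • pt d) (pt d) ?_ fun S hS hSq => Or.inr ⟨hS, d, hd, fun d' hd' =>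
          hptinj (eq_of_mem_closedBall_two_smul (hptnorm d) (hptnorm d') (hSq hd'))⟩
        rw [two_smul, sub_add_cancel_left, norm_neg, hptnorm]
    · obtain ⟨q, hq, hq'⟩ := exists_closedBall_disjoint (isCompact_range hpt) (range_nonempty pt)
        (by rintro _ ⟨d, rfl⟩; exact hptnorm d) hc
        (by rintro _ ⟨d, rfl⟩ _ ⟨d', rfl⟩; exact hptc d d') hx
      exact fan q x hq fun S hS hSq => Or.inl ⟨hS, fun d hd => hq' _ ⟨d, rfl⟩ (hSq hd)⟩
  · -- a colour that is frequent on `κ` branches swallows all sets through some point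
    have key : ∀ Q : Set (Set E), κ ≤ Cardinal.mk {α ∈ T | ∀ k, ∃ n ≥ k, H α n ∈ Q} →
        ∃ x, ∀ S ∈ M ∪ (N ∪ N'), x ∈ S → S ∈ Q := by
      intro Q hQ
      obtain ⟨d, hd⟩ := hMA.exists_lastHit hκ T hT.le fun α n => H α n ∈ Q
      have hfull : Full d := by
        choose n hn using fun α : {α ∈ T | ∀ k, ∃ n ≥ k, H α n ∈ Q} => (hd α α.2.1).1 α.2.2
        refine hQ.trans (Cardinal.mk_le_of_injective (f := fun α =>
          ⟨H α (n α), ⟨α, α.2.1, n α, rfl⟩, (hH _ _ _).mpr (hn α)⟩) ?_)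
        intro α β h
        exact Subtype.ext (hHinj _ _ _ _ (congrArg Subtype.val h)).1
      refine ⟨pt d, ?_⟩
      rintro S (⟨α, hα, n, rfl⟩ | ⟨-, hS⟩ | ⟨-, d', hd', hS⟩) hdS
      · exact (hd α hα).2 n ((hH _ _ _).mp hdS)
      · exact absurd hdS (hS d)
      · exact absurd (hS d hdS ▸ hfull) hd'
    rintro ⟨𝒜, ℬ, h𝒜, hℬ, hdisj, hcov𝒜, hcovℬ⟩
    have hunion : T ⊆ {α ∈ T | ∀ k, ∃ n ≥ k, H α n ∈ 𝒜} ∪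
        {α ∈ T | ∀ k, ∃ n ≥ k, H α n ∈ 𝒜ᶜ} := by
      intro α hα
      by_cases h : ∀ k, ∃ n ≥ k, H α n ∈ 𝒜
      · exact Or.inl ⟨hα, h⟩
      · push Not at h
        obtain ⟨k, hk⟩ := h
        exact Or.inr ⟨hα, fun j => ⟨max j k, le_max_left _ _, hk _ (le_max_right _ _)⟩⟩
    have hcard : κ ≤ Cardinal.mk {α ∈ T | ∀ k, ∃ n ≥ k, H α n ∈ 𝒜} ∨
        κ ≤ Cardinal.mk {α ∈ T | ∀ k, ∃ n ≥ k, H α n ∈ 𝒜ᶜ} := by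
      by_contra h
      push Not at h
      refine absurd (Cardinal.add_lt_of_lt hκ h.1 h.2) (not_lt.mpr ?_)
      rw [← hT]
      exact (Cardinal.mk_le_mk_of_subset hunion).trans (Cardinal.mk_union_le _ _)
    rcases hcard with h | h
    · obtain ⟨x, hx⟩ := key 𝒜 h
      obtain ⟨S, hS, hxS⟩ := hcovℬ x
      exact disjoint_left.mp hdisj (hx S (hℬ hS) hxS) hS
    · obtain ⟨x, hx⟩ := key 𝒜ᶜ h
      obtain ⟨S, hS, hxS⟩ := hcov𝒜 x
      exact hx S (h𝒜 hS) hxS hS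

theorem theorem8p1 (n : ℕ) (hn : 1 < n) (κ : Cardinal.{0})
    (hκ : Cardinal.aleph0 ≤ κ) (hκ' : κ < 2 ^ Cardinal.aleph0) (hMA : MASigmaCentered κ) :
    ∃ (C : Set (EuclideanSpace ℝ (Fin n))) (ℋ : Set (Set (EuclideanSpace ℝ (Fin n)))),
      IsCompact C ∧ Convex ℝ C ∧
      (∀ H ∈ ℋ, IsClosed H ∧ IsIsometricCopy H C) ∧
      IsFoldCover κ ℋ ∧
      ¬ SplitsIntoTwoCovers ℋ := by
  refine hMA.exists_convex_cover_not_splits hκ hκ'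
    (u := EuclideanSpace.single ⟨0, by omega⟩ 1) (v := EuclideanSpace.single ⟨1, hn⟩ 1) ?_ ?_ ?_
  · simp
  · simp
  · simp [EuclideanSpace.inner_single_left]
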